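/- Let $d\ge 2$ be a fixed integer and $0\le\delta<1$. For each $n$ let $0\le s_n\le 1$ and $0\le q_n\le p_n\le 1$, with $s_n=n^{-(d-1)+\delta+o(1)}$ as $n\to\infty$. Let $\mathcal H$ be the random $d$-uniform hypergraph on $[n]$ that contains each $d$-element subset of $[n]$ independently with probability $s_n$, and let $\mathcal P(\mathcal H)$ be the graph on $[n]$ in which two distinct vertices are adjacent if and only if some hyperedge of $\mathcal H$ contains both. Given $\mathcal H$, let $A$ be the random graph on $[n]$ that contains each unordered pair of distinct vertices independently, with probability $p_n$ if the pair is an edge of $\mathcal P(\mathcal H)$ and with probability $q_n$ otherwise. An estimator is any map $\widehat{\mathcal H}$ from graphs on $[n]$ to $d$-uniform hypergraphs on $[n]$. Suppose that one of the following holds. 1. $p_n\to 0$ (with any $0\le q_n\le p_n$; $q_n=0$ is allowed). 2. $q_n=n^{-1+\beta+o(1)}$ for a constant $\beta>\frac{2\delta}{d(d-1)}+\frac{d-2}{d}$, and $\delta\le\frac{d-1}{d+1}$ (with any $q_n\le p_n\le 1$; $p_n=1$ is allowed). Then no estimator does better than $(1-o(1))\,s_n\binom nd$, and this is the optimal risk: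 for every $\varepsilon>0$ and all sufficiently large $n$, every estimator satisfies $$\mathbb E\big[\,|\widehat{\mathcal H}(A)\,\triangle\,\mathcal H|\,\big]\;\ge\;(1-\varepsilon)\,s_n\binom nd ,$$ and some estimator satisfies $\mathbb E\big[|\widehat{\mathcal H}(A)\triangle\mathcal H|\big]\le s_n\binom nd$. -/

import Mathlib

open Filter Topology
open scoped symmDiff

/-- The potential hyperedges: all subsets of the `n` vertices with exactly `d` elements. -/
abbrev HyperEdge (n d : ℕ) : Type := {Ψ : Finset (Fin n) // Ψ.card = d}

/-- A `d`-uniform hypergraph on `n` vertices, identified with its set of hyperedges. -/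
abbrev UniformHypergraph (n d : ℕ) : Type := Finset (HyperEdge n d)

/-- The projection graph: two distinct vertices are adjacent iff some hyperedge contains both. -/
def projectionGraph {n d : ℕ} (H : UniformHypergraph n d) : SimpleGraph (Fin n) where
  Adj i j := i ≠ j ∧ ∃ Ψ ∈ H, i ∈ Ψ.1 ∧ j ∈ Ψ.1
  symm := ⟨fun _ _ h => ⟨h.1.symm, h.2.imp fun _ hΨ => ⟨hΨ.1, hΨ.2.2, hΨ.2.1⟩⟩⟩
  loopless := ⟨fun _ h => h.1 rfl⟩

/-- The probability of the hypergraph `H` when every potential hyperedge is included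
independently with probability `s`. -/
noncomputable def hypergraphProb {n d : ℕ} (s : ℝ) (H : UniformHypergraph n d) : ℝ :=
  ∏ Ψ : HyperEdge n d, if Ψ ∈ H then s else 1 - s

open Classical in
/-- The conditional probability of observing the graph `A` given the hypergraph `H`: every
unordered pair of distinct vertices is included independently, with probability `p` if it is an
edge of the projection graph of `H`, and with probability `q` otherwise. -/
noncomputable def graphProb {n d : ℕ} (p q : ℝ) (H : UniformHypergraph n d)
    (A : SimpleGraph (Fin n)) : ℝ :=
  ∏ e ∈ (⊤ : SimpleGraph (Fin n)).edgeFinset,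
    if e ∈ A.edgeSet then (if e ∈ (projectionGraph H).edgeSet then p else q)
    else 1 - (if e ∈ (projectionGraph H).edgeSet then p else q)

open Classical in
/-- The expectation of `f H A` when `(H, A)` is drawn from the noisy projection model. -/
noncomputable def modelExpectation (n d : ℕ) (s p q : ℝ)
    (f : UniformHypergraph n d → SimpleGraph (Fin n) → ℝ) : ℝ :=
  ∑ H : UniformHypergraph n d, ∑ A : SimpleGraph (Fin n),
    hypergraphProb s H * graphProb p q H A * f H A

/-- An estimator of the hypergraph: an arbitrary function of the observed graph. -/
abbrev Estimator (n d : ℕ) : Type := SimpleGraph (Fin n) → UniformHypergraph n d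

/-- The risk of an estimator: the expected size of the symmetric difference between the estimate
and the true hypergraph. -/
noncomputable def risk {n d : ℕ} (s p q : ℝ) (Hhat : Estimator n d) : ℝ :=
  modelExpectation n d s p q fun H A => ((Hhat A ∆ H).card : ℝ)

/-- `a n = n ^ (x + o(1))` as `n → ∞`. -/
def HasExponent (a : ℕ → ℝ) (x : ℝ) : Prop :=
  ∃ e : ℕ → ℝ, Tendsto e atTop (𝓝 0) ∧ ∀ᶠ n : ℕ in atTop, a n = (n : ℝ) ^ (x + e n)

/-- No estimator reconstructs a positive fraction of the hypergraph: uniformly over all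
estimators, the risk is at least `(1 - o(1)) * s * (n choose d)`, and the smallest possible risk
equals this quantity, because some estimator has risk at most `s * (n choose d)`. -/
def ReconstructionImpossible (d : ℕ) (s p q : ℕ → ℝ) : Prop :=
  ∀ ε : ℝ, 0 < ε → ∀ᶠ n : ℕ in atTop,
    (∀ Hhat : Estimator n d,
      (1 - ε) * (s n * (n.choose d : ℝ)) ≤ risk (s n) (p n) (q n) Hhat) ∧
    (∃ Hhat : Estimator n d, risk (s n) (p n) (q n) Hhat ≤ s n * (n.choose d : ℝ))

/-!
By linearity the risk splits over the potential hyperedges `Ψ`. For a single `Ψ` the best guess is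
the likelier of the two events `Ψ ∈ H` and `Ψ ∉ H` given `A`, so on every graph `A` for which `Ψ`
has posterior probability at most `1 / 2`, no guess errs less than the guess `Ψ ∉ H`. If,
conditionally on `Ψ ∈ H`, the graph is of this kind with probability at least `r`, the risk is
therefore at least `r * s * (n choose d)` (`le_risk`).

The posterior odds of `Ψ` are controlled by comparing each `H` with `insert Ψ H`
(`sum_mem_le_sum_not_mem`). The prior odds are `s / (1 - s)`, which tend to `0`; the likelihoods
differ only in the factors of the `d choose 2` pairs inside `Ψ`.

* If `p` tends to `0`, then `A` has no edge inside a given hyperedge with probability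
  `(1 - p) ^ (d choose 2)`, which tends to `1` (`sum_graphProb_no_edge`), and for such `A` adding `Ψ`
  only lowers the likelihood (`graphProb_insert_le`).
* In general adding `Ψ` multiplies the likelihood by at most `q ^ (-(d choose 2))`
  (`graphProb_insert_mul_pow_le`). The lower bound on `β` means that `s` is of smaller order than
  `q ^ (d choose 2)`, so the posterior odds of every `Ψ` tend to `0` uniformly in `A`, that is, `r`
  can be taken to be `1`.

The estimator that always answers with the empty hypergraph has risk exactly
`s * (n choose d)` (`risk_empty`).
-/

/-! ### Sums over random sets and random graphs -/

theorem sum_finset_prod_ite {α : Type*} [Fintype α] [DecidableEq α] (f g : α → ℝ) :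
    ∑ H : Finset α, ∏ a, (if a ∈ H then f a else g a) = ∏ a, (f a + g a) := by
  rw [Finset.prod_add, Finset.powerset_univ]
  refine Finset.sum_congr rfl fun H _ => ?_
  rw [Finset.prod_ite]
  congr 2 <;> ext <;> simp

open Classical in
theorem sum_simpleGraph_prod_ite {n : ℕ} (f g : Sym2 (Fin n) → ℝ) :
    ∑ A : SimpleGraph (Fin n), ∏ e ∈ (⊤ : SimpleGraph (Fin n)).edgeFinset,
        (if e ∈ A.edgeSet then f e else g e) =
      ∏ e ∈ (⊤ : SimpleGraph (Fin n)).edgeFinset, (f e + g e) := by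
  rw [Finset.prod_add]
  refine Finset.sum_bij' (fun A _ => A.edgeFinset)
    (fun t _ => SimpleGraph.fromEdgeSet (t : Set (Sym2 (Fin n)))) ?_ ?_ ?_ ?_ ?_
  · intro A _
    rw [Finset.mem_powerset]
    exact SimpleGraph.edgeFinset_mono le_top
  · intro t _
    exact Finset.mem_univ _
  · intro A _
    simp
  · intro t ht
    rw [Finset.mem_powerset] at ht
    ext e
    have := @ht e
    simp at this ⊢
    exact this
  · intro A _
    rw [Finset.prod_ite]
    congr 2
    · ext e
      simpa using fun h => A.not_isDiag_of_mem_edgeSet h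
    · ext e
      simp

/-! ### Edges inside a hyperedge -/

theorem mem_edgeSet_projectionGraph {n d : ℕ} (H : UniformHypergraph n d) (e : Sym2 (Fin n)) :
    e ∈ (projectionGraph H).edgeSet ↔ ¬ e.IsDiag ∧ ∃ Ψ ∈ H, e ∈ Ψ.1.sym2 := by
  induction e with
  | h i j => simp [projectionGraph]

open Classical in
theorem card_edgeFinset_filter_mem_sym2 {n : ℕ} (S : Finset (Fin n)) :
    ((⊤ : SimpleGraph (Fin n)).edgeFinset.filter (· ∈ S.sym2)).card = S.card.choose 2 := by
  rw [← Sym2.card_image_offDiag]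
  congr 1
  ext e
  induction e with
  | h i j =>
    simp only [Finset.mem_filter, SimpleGraph.mem_edgeFinset, SimpleGraph.mem_edgeSet,
      SimpleGraph.top_adj, Finset.mk_mem_sym2_iff, Finset.mem_image, Finset.mem_offDiag,
      Prod.exists]
    constructor
    · rintro ⟨h, hi, hj⟩
      exact ⟨i, j, ⟨hi, hj, h⟩, rfl⟩
    · rintro ⟨a, b, ⟨ha, hb, hab⟩, h⟩
      rcases Sym2.eq_iff.1 h with ⟨rfl, rfl⟩ | ⟨rfl, rfl⟩
      · exact ⟨hab, ha, hb⟩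
      · exact ⟨hab.symm, hb, ha⟩

open Classical in
theorem prod_edgeFinset_ite_mem_sym2 {n d : ℕ} (Ψ : HyperEdge n d) (c : ℝ) :
    ∏ e ∈ (⊤ : SimpleGraph (Fin n)).edgeFinset, (if e ∈ Ψ.1.sym2 then c else 1) =
      c ^ d.choose 2 := by
  rw [← Finset.prod_filter, Finset.prod_const, card_edgeFinset_filter_mem_sym2, Ψ.2]

/-! ### The laws of the hypergraph and of the graph -/

theorem hypergraphProb_nonneg {n d : ℕ} {s : ℝ} (h0 : 0 ≤ s) (h1 : s ≤ 1)
    (H : UniformHypergraph n d) : 0 ≤ hypergraphProb s H :=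
  Finset.prod_nonneg fun Ψ _ => by split_ifs <;> linarith

theorem graphProb_nonneg {n d : ℕ} {p q : ℝ} (h0 : 0 ≤ q) (hqp : q ≤ p) (h1 : p ≤ 1)
    (H : UniformHypergraph n d) (A : SimpleGraph (Fin n)) : 0 ≤ graphProb p q H A :=
  Finset.prod_nonneg fun e _ => by split_ifs <;> linarith

theorem sum_graphProb {n d : ℕ} (p q : ℝ) (H : UniformHypergraph n d) :
    ∑ A, graphProb p q H A = 1 := by
  classical
  unfold graphProb
  rw [sum_simpleGraph_prod_ite]
  simp

theorem hypergraphProb_insert {n d : ℕ} (s : ℝ) {H : UniformHypergraph n d} {Ψ : HyperEdge n d}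
    (h : Ψ ∉ H) :
    (1 - s) * hypergraphProb s (insert Ψ H) = s * hypergraphProb s H := by
  unfold hypergraphProb
  rw [← Finset.mul_prod_erase _ _ (Finset.mem_univ Ψ),
    ← Finset.mul_prod_erase Finset.univ (fun Φ => if Φ ∈ H then s else 1 - s)
      (Finset.mem_univ Ψ)]
  rw [if_pos (Finset.mem_insert_self _ _), if_neg h, mul_left_comm]
  congr 2
  refine Finset.prod_congr rfl fun Φ hΦ => ?_
  simp [Finset.mem_insert, Finset.ne_of_mem_erase hΦ]

theorem sum_hypergraphProb_mem {n d : ℕ} (s : ℝ) (Ψ : HyperEdge n d) :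
    ∑ H : UniformHypergraph n d with Ψ ∈ H, hypergraphProb s H = s := by
  -- Dropping the factor `1 - s` at `Ψ` restricts the sum to the hypergraphs that contain `Ψ`.
  have key : ∀ H : UniformHypergraph n d, (if Ψ ∈ H then hypergraphProb s H else 0) =
      ∏ Φ, if Φ ∈ H then s else (if Φ = Ψ then 0 else 1 - s) := by
    intro H
    split_ifs with h
    · refine Finset.prod_congr rfl fun Φ _ => ?_
      split_ifs with h1 h2
      · rfl
      · exact absurd (h2 ▸ h) h1
      · rfl
    · exact (Finset.prod_eq_zero (Finset.mem_univ Ψ) (by simp [h])).symm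
  rw [Finset.sum_filter, Finset.sum_congr rfl fun H _ => key H, sum_finset_prod_ite]
  rw [Finset.prod_eq_single_of_mem Ψ (Finset.mem_univ Ψ)]
  · simp
  · intro Φ _ h
    simp [h]

open Classical in
/-- If `Ψ` is a hyperedge, then all of its pairs are edges of the projection graph, so none of
them is observed with probability `(1 - p) ^ (d choose 2)`. -/
theorem sum_graphProb_no_edge {n d : ℕ} (p q : ℝ) {H : UniformHypergraph n d}
    {Ψ : HyperEdge n d} (h : Ψ ∈ H) :
    ∑ A : SimpleGraph (Fin n) with ∀ e ∈ A.edgeSet, e ∉ Ψ.1.sym2, graphProb p q H A =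
      (1 - p) ^ d.choose 2 := by
  -- Dropping the factors of the edges inside `Ψ` restricts the sum to the graphs without them.
  have key : ∀ A : SimpleGraph (Fin n),
      (if ∀ e ∈ A.edgeSet, e ∉ Ψ.1.sym2 then graphProb p q H A else 0) =
      ∏ e ∈ (⊤ : SimpleGraph (Fin n)).edgeFinset,
        if e ∈ A.edgeSet then
          (if e ∈ Ψ.1.sym2 then 0 else if e ∈ (projectionGraph H).edgeSet then p else q)
        else 1 - (if e ∈ (projectionGraph H).edgeSet then p else q) := by
    intro A
    split_ifs with hA
    · refine Finset.prod_congr rfl fun e _ => ?_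
      by_cases he : e ∈ A.edgeSet
      · simp [he, hA e he]
      · simp [he]
    · push Not at hA
      obtain ⟨e, he, heΨ⟩ := hA
      refine (Finset.prod_eq_zero (i := e) ?_ (by simp [he, heΨ])).symm
      simpa using A.not_isDiag_of_mem_edgeSet he
  rw [Finset.sum_filter, Finset.sum_congr rfl fun A _ => key A, sum_simpleGraph_prod_ite,
    ← prod_edgeFinset_ite_mem_sym2 Ψ]
  refine Finset.prod_congr rfl fun e he => ?_
  by_cases heΨ : e ∈ Ψ.1.sym2
  · have : e ∈ (projectionGraph H).edgeSet :=
      (mem_edgeSet_projectionGraph H e).2 ⟨by simpa using he, Ψ, h, heΨ⟩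
    simp [heΨ, this]
  · simp [heΨ]

/-! ### Likelihood ratio of adding a hyperedge -/

/-- Adding a hyperedge changes only the factors of the `d choose 2` pairs inside it, and each of
them grows by a factor of at most `p / q ≤ 1 / q`. -/
theorem graphProb_insert_mul_pow_le {n d : ℕ} {p q : ℝ} (h0 : 0 ≤ q) (hqp : q ≤ p) (h1 : p ≤ 1)
    (H : UniformHypergraph n d) (Ψ : HyperEdge n d) (A : SimpleGraph (Fin n)) :
    graphProb p q (insert Ψ H) A * q ^ d.choose 2 ≤ graphProb p q H A := by
  classical
  rw [← prod_edgeFinset_ite_mem_sym2 Ψ]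
  unfold graphProb
  rw [← Finset.prod_mul_distrib]
  refine Finset.prod_le_prod (fun e _ => ?_) fun e he => ?_
  · split_ifs <;> nlinarith
  · have hdiag : ¬ e.IsDiag := by simpa using he
    by_cases heΨ : e ∈ Ψ.1.sym2
    · have : e ∈ (projectionGraph (insert Ψ H)).edgeSet :=
        (mem_edgeSet_projectionGraph _ e).2 ⟨hdiag, Ψ, Finset.mem_insert_self _ _, heΨ⟩
      simp only [heΨ, this, if_true]
      split_ifs <;> nlinarith
    · have : e ∈ (projectionGraph (insert Ψ H)).edgeSet ↔ e ∈ (projectionGraph H).edgeSet := by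
        simp only [mem_edgeSet_projectionGraph, Finset.exists_mem_insert, heΨ, false_or]
      simp [heΨ, this]

/-- If no pair inside `Ψ` is observed, then adding the hyperedge `Ψ` only lowers the
likelihood. -/
theorem graphProb_insert_le {n d : ℕ} {p q : ℝ} (h0 : 0 ≤ q) (hqp : q ≤ p) (h1 : p ≤ 1)
    (H : UniformHypergraph n d) (Ψ : HyperEdge n d) {A : SimpleGraph (Fin n)}
    (hA : ∀ e ∈ A.edgeSet, e ∉ Ψ.1.sym2) :
    graphProb p q (insert Ψ H) A ≤ graphProb p q H A := by
  classical
  unfold graphProb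
  refine Finset.prod_le_prod (fun e _ => ?_) fun e he => ?_
  · split_ifs <;> linarith
  · have hdiag : ¬ e.IsDiag := by simpa using he
    by_cases heΨ : e ∈ Ψ.1.sym2
    · have h2 : e ∈ (projectionGraph (insert Ψ H)).edgeSet :=
        (mem_edgeSet_projectionGraph _ e).2 ⟨hdiag, Ψ, Finset.mem_insert_self _ _, heΨ⟩
      have h3 : e ∉ A.edgeSet := fun h => hA e h heΨ
      simp only [h2, h3, if_true, if_false]
      split_ifs <;> linarith
    · have : e ∈ (projectionGraph (insert Ψ H)).edgeSet ↔ e ∈ (projectionGraph H).edgeSet := by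
        simp only [mem_edgeSet_projectionGraph, Finset.exists_mem_insert, heΨ, false_or]
      simp [this]

/-- If the likelihood ratio of adding `Ψ` is at most `1 / c`, and the prior odds of `Ψ` are at most
`c`, then the posterior probability of `Ψ` given `A` is at most `1 / 2`. -/
theorem sum_mem_le_sum_not_mem {n d : ℕ} {s p q c : ℝ} (hs0 : 0 ≤ s) (hs1 : s < 1)
    (h0 : 0 ≤ q) (hqp : q ≤ p) (h1 : p ≤ 1) (hc : s ≤ (1 - s) * c)
    (Ψ : HyperEdge n d) (A : SimpleGraph (Fin n))
    (hA : ∀ H : UniformHypergraph n d, graphProb p q (insert Ψ H) A * c ≤ graphProb p q H A) :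
    ∑ H : UniformHypergraph n d with Ψ ∈ H, hypergraphProb s H * graphProb p q H A ≤
      ∑ H : UniformHypergraph n d with Ψ ∉ H, hypergraphProb s H * graphProb p q H A := by
  have hsum : ∑ H : UniformHypergraph n d with Ψ ∈ H, hypergraphProb s H * graphProb p q H A =
      ∑ H : UniformHypergraph n d with Ψ ∉ H,
        hypergraphProb s (insert Ψ H) * graphProb p q (insert Ψ H) A := by
    refine Finset.sum_bij' (fun H _ => H.erase Ψ) (fun H _ => insert Ψ H) ?_ ?_ ?_ ?_ ?_
    · simp
    · simp
    · intro H hH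
      exact Finset.insert_erase (Finset.mem_filter.1 hH).2
    · intro H hH
      exact Finset.erase_insert (Finset.mem_filter.1 hH).2
    · intro H hH
      rw [Finset.insert_erase (Finset.mem_filter.1 hH).2]
  rw [hsum]
  refine Finset.sum_le_sum fun H hH => ?_
  have hprior := hypergraphProb_insert s (Finset.mem_filter.1 hH).2
  have hH0 := hypergraphProb_nonneg hs0 hs1.le H
  have hG0 := graphProb_nonneg h0 hqp h1 (insert Ψ H) A
  have hs' : 0 < 1 - s := by linarith
  refine le_of_mul_le_mul_left ?_ hs'
  calc (1 - s) * (hypergraphProb s (insert Ψ H) * graphProb p q (insert Ψ H) A)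
      = hypergraphProb s H * graphProb p q (insert Ψ H) A * s := by
        rw [← mul_assoc, hprior]; ring
    _ ≤ hypergraphProb s H * graphProb p q (insert Ψ H) A * ((1 - s) * c) :=
        mul_le_mul_of_nonneg_left hc (mul_nonneg hH0 hG0)
    _ = (1 - s) * hypergraphProb s H * (graphProb p q (insert Ψ H) A * c) := by ring
    _ ≤ (1 - s) * hypergraphProb s H * graphProb p q H A :=
        mul_le_mul_of_nonneg_left (hA H) (mul_nonneg hs'.le hH0)
    _ = (1 - s) * (hypergraphProb s H * graphProb p q H A) := by ring

/-! ### The risk, hyperedge by hyperedge -/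

theorem risk_eq_sum {n d : ℕ} (s p q : ℝ) (Hhat : Estimator n d) :
    risk s p q Hhat = ∑ Ψ : HyperEdge n d, ∑ A,
      ∑ H : UniformHypergraph n d with Ψ ∈ Hhat A ∆ H,
        hypergraphProb s H * graphProb p q H A := by
  unfold risk modelExpectation
  simp only [Finset.card_eq_sum_ones, Nat.cast_sum, Nat.cast_one, Finset.mul_sum, mul_one]
  rw [Finset.sum_comm, Finset.sum_comm (s := (Finset.univ : Finset (HyperEdge n d)))]
  refine Finset.sum_congr rfl fun A _ => ?_
  simp only [Finset.sum_filter]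
  rw [Finset.sum_comm (s := (Finset.univ : Finset (HyperEdge n d)))]
  refine Finset.sum_congr rfl fun H _ => ?_
  rw [← Finset.sum_filter, Finset.filter_mem_eq_inter, Finset.univ_inter]

theorem risk_empty {n d : ℕ} (s p q : ℝ) :
    risk s p q (fun _ => ∅ : Estimator n d) = s * (n.choose d : ℝ) := by
  rw [risk_eq_sum]
  have key : ∀ Ψ : HyperEdge n d, ∑ A, ∑ H : UniformHypergraph n d with Ψ ∈ ∅ ∆ H,
      hypergraphProb s H * graphProb p q H A = s := by
    intro Ψ
    rw [Finset.sum_comm]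
    simp only [← Finset.mul_sum, sum_graphProb, mul_one]
    simpa [← Finset.bot_eq_empty] using sum_hypergraphProb_mem s Ψ
  rw [Finset.sum_congr rfl fun Ψ _ => key Ψ]
  simp [mul_comm]

open Classical in
/-- Whatever the estimator says about `Ψ`, on a graph for which `Ψ` has posterior probability at
most `1 / 2` it errs at least as often as one that never reports `Ψ`. So the risk is at least the
expected number of hyperedges `Ψ` for which the graph is of that kind. -/
theorem le_risk {n d : ℕ} {s p q r : ℝ} (hs0 : 0 ≤ s) (hs1 : s ≤ 1)
    (h0 : 0 ≤ q) (hqp : q ≤ p) (h1 : p ≤ 1) (good : HyperEdge n d → SimpleGraph (Fin n) → Prop)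
    (hgood : ∀ Ψ A, good Ψ A →
      ∑ H : UniformHypergraph n d with Ψ ∈ H, hypergraphProb s H * graphProb p q H A ≤
        ∑ H : UniformHypergraph n d with Ψ ∉ H, hypergraphProb s H * graphProb p q H A)
    (hr : ∀ Ψ, ∀ H : UniformHypergraph n d, Ψ ∈ H → r ≤ ∑ A with good Ψ A, graphProb p q H A)
    (Hhat : Estimator n d) :
    r * (s * (n.choose d : ℝ)) ≤ risk s p q Hhat := by
  have hw : ∀ (H : UniformHypergraph n d) A, 0 ≤ hypergraphProb s H * graphProb p q H A :=
    fun H A => mul_nonneg (hypergraphProb_nonneg hs0 hs1 H) (graphProb_nonneg h0 hqp h1 H A)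
  rw [risk_eq_sum]
  have key : ∀ Ψ : HyperEdge n d, r * s ≤ ∑ A,
      ∑ H : UniformHypergraph n d with Ψ ∈ Hhat A ∆ H,
        hypergraphProb s H * graphProb p q H A := by
    intro Ψ
    calc r * s = ∑ H : UniformHypergraph n d with Ψ ∈ H, hypergraphProb s H * r := by
          rw [← Finset.sum_mul, sum_hypergraphProb_mem, mul_comm]
      _ ≤ ∑ H : UniformHypergraph n d with Ψ ∈ H,
            ∑ A with good Ψ A, hypergraphProb s H * graphProb p q H A := by
          refine Finset.sum_le_sum fun H hH => ?_
          rw [← Finset.mul_sum]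
          exact mul_le_mul_of_nonneg_left (hr Ψ H (Finset.mem_filter.1 hH).2)
            (hypergraphProb_nonneg hs0 hs1 H)
      _ = ∑ A with good Ψ A, ∑ H : UniformHypergraph n d with Ψ ∈ H,
            hypergraphProb s H * graphProb p q H A := Finset.sum_comm
      _ ≤ ∑ A with good Ψ A, ∑ H : UniformHypergraph n d with Ψ ∈ Hhat A ∆ H,
            hypergraphProb s H * graphProb p q H A := by
          refine Finset.sum_le_sum fun A hA => ?_
          by_cases hΨ : Ψ ∈ Hhat A
          · simpa [Finset.mem_symmDiff, hΨ] using hgood Ψ A (Finset.mem_filter.1 hA).2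
          · simp [Finset.mem_symmDiff, hΨ]
      _ ≤ _ := Finset.sum_le_sum_of_subset_of_nonneg (Finset.filter_subset _ _)
          fun A _ _ => Finset.sum_nonneg fun H _ => hw H A
  calc r * (s * (n.choose d : ℝ)) = ∑ _Ψ : HyperEdge n d, r * s := by
        simp; ring
    _ ≤ _ := Finset.sum_le_sum fun Ψ _ => key Ψ

/-! ### Polynomial growth rates -/

theorem HasExponent.tendsto_zero {a : ℕ → ℝ} {x : ℝ} (h : HasExponent a x) (hx : x < 0) :
    Tendsto a atTop (𝓝 0) := by
  obtain ⟨e, he, ha⟩ := h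
  have hlim : Tendsto (fun n : ℕ => (n : ℝ) ^ (x / 2)) atTop (𝓝 0) := by
    have := (tendsto_rpow_neg_atTop (y := -(x / 2)) (by linarith)).comp
      tendsto_natCast_atTop_atTop
    simpa [Function.comp_def] using this
  have hsmall : ∀ᶠ n in atTop, e n < -(x / 2) := he.eventually_lt_const (by linarith)
  refine squeeze_zero' ?_ ?_ hlim
  · filter_upwards [ha] with n hn
    rw [hn]
    positivity
  · filter_upwards [ha, hsmall, eventually_ge_atTop 1] with n hn hen h1
    rw [hn]
    exact Real.rpow_le_rpow_of_exponent_le (by exact_mod_cast h1) (by linarith)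

theorem HasExponent.pow {a : ℕ → ℝ} {x : ℝ} (h : HasExponent a x) (N : ℕ) :
    HasExponent (fun n => a n ^ N) (x * N) := by
  obtain ⟨e, he, ha⟩ := h
  refine ⟨fun n => e n * N, by simpa using he.mul_const (N : ℝ), ?_⟩
  filter_upwards [ha] with n hn
  rw [hn, ← Real.rpow_natCast, ← Real.rpow_mul (Nat.cast_nonneg n), add_mul]

theorem HasExponent.div {a b : ℕ → ℝ} {x y : ℝ} (ha : HasExponent a x) (hb : HasExponent b y) :
    HasExponent (fun n => a n / b n) (x - y) := by
  obtain ⟨e, he, ha⟩ := ha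
  obtain ⟨f, hf, hb⟩ := hb
  refine ⟨fun n => e n - f n, by simpa using he.sub hf, ?_⟩
  filter_upwards [ha, hb, eventually_ge_atTop 1] with n hn hm h1
  rw [hn, hm, ← Real.rpow_sub (by exact_mod_cast h1)]
  congr 1
  ring

theorem HasExponent.eventually_pos {a : ℕ → ℝ} {x : ℝ} (h : HasExponent a x) :
    ∀ᶠ n in atTop, 0 < a n := by
  obtain ⟨e, -, ha⟩ := h
  filter_upwards [ha, eventually_ge_atTop 1] with n hn h1
  rw [hn]
  exact Real.rpow_pos_of_pos (by exact_mod_cast h1) _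

/-! ### Impossibility of reconstruction -/

theorem proposition1p8 (d : ℕ) (hd : 2 ≤ d) (δ : ℝ) (hδ0 : 0 ≤ δ) (hδ1 : δ < 1)
    (s p q : ℕ → ℝ)
    (hs01 : ∀ n, 0 ≤ s n ∧ s n ≤ 1)
    (hpq : ∀ n, 0 ≤ q n ∧ q n ≤ p n ∧ p n ≤ 1)
    (hs : HasExponent s (-((d : ℝ) - 1) + δ)) :
    (Tendsto p atTop (𝓝 0) → ReconstructionImpossible d s p q) ∧
    (∀ β : ℝ, HasExponent q (-1 + β) →
      δ ≤ ((d : ℝ) - 1) / ((d : ℝ) + 1) →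
      2 * δ / ((d : ℝ) * ((d : ℝ) - 1)) + ((d : ℝ) - 2) / (d : ℝ) < β →
      ReconstructionImpossible d s p q) := by
  have hd' : (2 : ℝ) ≤ d := by exact_mod_cast hd
  have hs_lim : Tendsto s atTop (𝓝 0) := hs.tendsto_zero (by linarith)
  have hs_half : ∀ᶠ n in atTop, s n < 1 / 2 := hs_lim.eventually_lt_const (by norm_num)
  refine ⟨fun hp ε hε => ?_, fun β hq _ hβ ε hε => ?_⟩
  · have hlim : Tendsto (fun n => (1 - p n) ^ d.choose 2) atTop (𝓝 1) := by
      simpa using (hp.const_sub 1).pow (d.choose 2)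
    filter_upwards [hs_half, hlim.eventually_const_le (show 1 - ε < 1 by linarith)]
      with n hsn hpn
    obtain ⟨hs0, hs1⟩ := hs01 n
    obtain ⟨h0, hqp, h1⟩ := hpq n
    refine ⟨fun Hhat => ?_, fun _ => ∅, (risk_empty _ _ _).le⟩
    refine le_risk hs0 hs1 h0 hqp h1 (fun Ψ A => ∀ e ∈ A.edgeSet, e ∉ Ψ.1.sym2)
      (fun Ψ A hA => ?_) (fun Ψ H hΨ => ?_) Hhat
    · refine sum_mem_le_sum_not_mem (c := 1) hs0 (by linarith) h0 hqp h1 (by linarith) Ψ A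
        fun H => ?_
      rw [mul_one]
      exact graphProb_insert_le h0 hqp h1 H Ψ hA
    · refine hpn.trans_eq ?_
      convert (sum_graphProb_no_edge (p n) (q n) hΨ).symm
  · -- The lower bound on `β` says that `s n` decays faster than `q n ^ (d choose 2)`.
    have hexp : (-((d : ℝ) - 1) + δ) - (-1 + β) * (d.choose 2 : ℕ) < 0 := by
      have hd1 : 0 < (d : ℝ) * (d - 1) := by nlinarith
      have h2 : 2 * δ / ((d : ℝ) * (d - 1)) + (d - 2) / d =
          (2 * δ + (d - 2) * (d - 1)) / (d * (d - 1)) := by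
        have : (d : ℝ) - 1 ≠ 0 := by linarith
        field_simp
      rw [h2, div_lt_iff₀ hd1] at hβ
      rw [Nat.cast_choose_two]
      nlinarith
    have hratio := (hs.div (hq.pow (d.choose 2))).tendsto_zero hexp
    filter_upwards [hs_half, hq.eventually_pos,
      hratio.eventually_lt_const (show (0 : ℝ) < 1 / 2 by norm_num)] with n hsn hqn hn
    obtain ⟨hs0, hs1⟩ := hs01 n
    obtain ⟨h0, hqp, h1⟩ := hpq n
    refine ⟨fun Hhat => ?_, fun _ => ∅, (risk_empty _ _ _).le⟩
    have hqN : 0 < q n ^ d.choose 2 := pow_pos hqn _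
    rw [div_lt_iff₀ hqN] at hn
    refine le_risk hs0 hs1 h0 hqp h1 (fun _ _ => True) (fun Ψ A _ => ?_) (fun Ψ H hΨ => ?_) Hhat
    · exact sum_mem_le_sum_not_mem hs0 (by linarith) h0 hqp h1 (by nlinarith) Ψ A
        fun H => graphProb_insert_mul_pow_le h0 hqp h1 H Ψ A
    · simp only [Finset.filter_true, sum_graphProb]
      linarith
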